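/- Let $\tilde a,a\in\mathbb R^{s\times s}$ and $\tilde\omega,\omega\in\mathbb R^s$ be the coefficients of an $s$-stage IMEX Runge–Kutta method: $\tilde a_{ij}=0$ for $j\ge i$, $a_{ij}=0$ for $j>i$, and all weights $\tilde\omega_i,\omega_i$ are non-zero. For smooth $f,g:\mathbb R^m\to\mathbb R^m$ and a step size $h>0$, the forward scheme for $y'=f(y)+g(y)$ is $$Y^{(i)}=y_n+h\sum_j\tilde a_{ij}f(Y^{(j)})+h\sum_j a_{ij}g(Y^{(j)}),\qquad y_{n+1}=y_n+h\sum_i\tilde\omega_i f(Y^{(i)})+h\sum_i\omega_i g(Y^{(i)}).$$ Put $\tilde\alpha_{ij}=\tilde\omega_j-\frac{\tilde\omega_j}{\tilde\omega_i}\tilde a_{ji}$, $\alpha_{ij}=\omega_j-\frac{\omega_j}{\tilde\omega_i}\tilde a_{ji}$, $\tilde\beta_{ij}=\tilde\omega_j-\frac{\tilde\omega_j}{\omega_i}a_{ji}$, $\beta_{ij}=\omega_j-\frac{\omega_j}{\omega_i}a_{ji}$, $\gamma_i=\sum_j\alpha_{ij}$ and $\tilde\gamma_i=\sum_j\tilde\alpha_{ij}$.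 The combined scheme consists of the forward scheme and of $$\tilde P^{(i)}=\tilde p_n-h\sum_j\tilde\alpha_{ij}f'(Y^{(j)})^T\tilde P^{(j)}-h\sum_j\alpha_{ij}g'(Y^{(j)})^TP^{(j)},$$ $$P^{(i)}=p_n-h\sum_j\tilde\beta_{ij}f'(Y^{(j)})^T\tilde P^{(j)}-h\sum_j\beta_{ij}g'(Y^{(j)})^TP^{(j)},$$ $$p_{n+1}=p_n-h\,\Delta,\qquad \tilde p_{n+1}=\tilde p_n-h\,\Delta,\qquad \Delta=\sum_i\tilde\omega_if'(Y^{(i)})^T\tilde P^{(i)}+\sum_i\omega_ig'(Y^{(i)})^TP^{(i)},$$ as a discretization of $y'=f(y)+g(y)$, $\tilde p'=p'=-f'(y)^T\tilde p-g'(y)^Tp$. (If $\tilde p_0=p_0$, then $\tilde p_n=p_n$ for all $n$, and this is the adjoint scheme obtained by discretizing first and then optimizing.) A scheme has order $q$ if, for all $m$, all smooth $f,g$ and every exact solution, the following holds in every ball around the initial state: for all sufficiently small $h>0$ one step with its forward stages in that ball exists, and every such step has an error $O(h^{q+1})$ in all its components. Then: 1. The combined scheme has first order if the forward scheme has first order.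 2. The combined scheme has second order if the forward scheme has second order. 3. The combined scheme has third order if the forward scheme has third order and either $$\sum_i\omega_i\gamma_i^2=\sum_i\omega_i\tilde\gamma_i^2=\sum_i\omega_i\gamma_i\tilde\gamma_i=\tfrac13,$$ or $$\sum_{i,j}\omega_ia_{ij}\gamma_j=\tfrac16,\qquad \sum_{i,j}\omega_i\tilde a_{ij}\tilde\gamma_j=\tfrac16,\qquad\text{and}\qquad \sum_{i,j}\omega_ia_{ij}\tilde\gamma_j=\tfrac16\ \text{ or }\ \sum_{i,j}\omega_i\tilde a_{ij}\gamma_j=\tfrac16 .$$ -/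

import Mathlib

open Set Filter Topology
open scoped ContDiff

/-- Coefficients of an implicit-explicit (additive) Runge–Kutta method with `s` stages.
`aE`, `wE` are the coefficients `ã`, `ω̃` of the explicit part and `aI`, `wI` the coefficients
`a`, `ω` of the (diagonally) implicit part. -/
structure IMEXTableau (s : ℕ) where
  aE : Matrix (Fin s) (Fin s) ℝ
  aI : Matrix (Fin s) (Fin s) ℝ
  wE : Fin s → ℝ
  wI : Fin s → ℝ
  explicit : ∀ i j, i ≤ j → aE i j = 0
  diagonally_implicit : ∀ i j, i < j → aI i j = 0

/-- The state space `ℝᵐ` with its Euclidean inner product. -/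
abbrev StateSpace (m : ℕ) : Type := EuclideanSpace ℝ (Fin m)

namespace IMEXTableau

noncomputable section

variable {s m : ℕ} (M : IMEXTableau s)

/-! ### Coefficients of the adjoint scheme -/

/-- `α̃ i j = ω̃ j - (ω̃ j / ω̃ i) ã j i` -/
def alphaE (i j : Fin s) : ℝ := M.wE j - M.wE j / M.wE i * M.aE j i

/-- `α i j = ω j - (ω j / ω̃ i) ã j i` -/
def alphaI (i j : Fin s) : ℝ := M.wI j - M.wI j / M.wE i * M.aE j i

/-- `β̃ i j = ω̃ j - (ω̃ j / ω i) a j i` -/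
def betaE (i j : Fin s) : ℝ := M.wE j - M.wE j / M.wI i * M.aI j i

/-- `β i j = ω j - (ω j / ω i) a j i` -/
def betaI (i j : Fin s) : ℝ := M.wI j - M.wI j / M.wI i * M.aI j i

/-- `γ̃ i = ∑ j, α̃ i j` -/
def gammaE (i : Fin s) : ℝ := ∑ j, M.alphaE i j

/-- `γ i = ∑ j, α i j` -/
def gammaI (i : Fin s) : ℝ := ∑ j, M.alphaI i j

/-! ### The forward scheme for `y' = f(y) + g(y)` -/

/-- `Y` are stage values of one step of size `h` from `y₀`; `f` is treated explicitly and `g`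
implicitly. -/
def IsForwardStages (f g : StateSpace m → StateSpace m) (h : ℝ) (y₀ : StateSpace m)
    (Y : Fin s → StateSpace m) : Prop :=
  ∀ i, Y i = y₀ + h • ∑ j, M.aE i j • f (Y j) + h • ∑ j, M.aI i j • g (Y j)

/-- The new value of the state computed from the stage values `Y`. -/
def forwardUpdate (f g : StateSpace m → StateSpace m) (h : ℝ) (y₀ : StateSpace m)
    (Y : Fin s → StateSpace m) : StateSpace m :=
  y₀ + h • ∑ i, M.wE i • f (Y i) + h • ∑ i, M.wI i • g (Y i)

/-- `y` solves `y' = f(y) + g(y)` on `[0, T]`. -/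
def IsForwardSolution (f g : StateSpace m → StateSpace m) (T : ℝ) (y : ℝ → StateSpace m) : Prop :=
  ∀ t ∈ Icc 0 T, HasDerivWithinAt y (f (y t) + g (y t)) (Icc 0 T) t

/-- The forward scheme has order (at least) `q`: for all smooth right-hand sides in all dimensions,
one step of small size `h > 0` from a point of an exact solution can be carried out with stages in
a given neighbourhood of that point, and every such step has an error `O(h ^ (q + 1))`. -/
def ForwardHasOrder (q : ℕ) : Prop :=
  ∀ (m : ℕ) (f g : StateSpace m → StateSpace m), ContDiff ℝ ∞ f → ContDiff ℝ ∞ g →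
    ∀ (T : ℝ) (y : ℝ → StateSpace m), 0 < T → IsForwardSolution f g T y →
      ∀ r > 0, ∃ C : ℝ, ∀ᶠ h in 𝓝[>] (0 : ℝ),
        (∃ Y : Fin s → StateSpace m,
          M.IsForwardStages f g h (y 0) Y ∧ ∀ i, Y i ∈ Metric.ball (y 0) r) ∧
        ∀ Y : Fin s → StateSpace m,
          M.IsForwardStages f g h (y 0) Y → (∀ i, Y i ∈ Metric.ball (y 0) r) →
            ‖M.forwardUpdate f g h (y 0) Y - y h‖ ≤ C * h ^ (q + 1)

/-! ### The combined scheme for the state `y` and the adjoint variables `p̃`, `p` -/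

/-- The transposed Jacobian `f'(y)ᵀ` applied to `p`. -/
def adjD (f : StateSpace m → StateSpace m) (y p : StateSpace m) : StateSpace m :=
  ContinuousLinearMap.adjoint (fderiv ℝ f y) p

/-- `Pt`, `P` are adjoint stage values of one step of size `h`, along the state stages `Y`. The
stages `Pt` belong to the variable `p̃` and the stages `P` to `p`; if the step starts from
`p̃₀ = p₀`, both kinds of stages start from `p₀`, and then `p̃ = p` holds after the step too. -/
def IsAdjointStages (f g : StateSpace m → StateSpace m) (h : ℝ) (pt₀ p₀ : StateSpace m)
    (Y Pt P : Fin s → StateSpace m) : Prop :=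
  (∀ i, Pt i = pt₀ - h • ∑ j, M.alphaE i j • adjD f (Y j) (Pt j)
      - h • ∑ j, M.alphaI i j • adjD g (Y j) (P j)) ∧
  (∀ i, P i = p₀ - h • ∑ j, M.betaE i j • adjD f (Y j) (Pt j)
      - h • ∑ j, M.betaI i j • adjD g (Y j) (P j))

/-- The new value of an adjoint variable with old value `p₀`; the formula is the same for `p`
and for `p̃`. -/
def adjointUpdate (f g : StateSpace m → StateSpace m) (h : ℝ) (p₀ : StateSpace m)
    (Y Pt P : Fin s → StateSpace m) : StateSpace m :=
  p₀ - h • ∑ i, M.wE i • adjD f (Y i) (Pt i) - h • ∑ i, M.wI i • adjD g (Y i) (P i)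

/-- `(y, p̃, p)` solves `y' = f(y) + g(y)`, `p̃' = p' = - f'(y)ᵀ p̃ - g'(y)ᵀ p` on `[0, T]`. -/
def IsCombinedSolution (f g : StateSpace m → StateSpace m) (T : ℝ)
    (y pt p : ℝ → StateSpace m) : Prop :=
  IsForwardSolution f g T y ∧
  (∀ t ∈ Icc 0 T,
    HasDerivWithinAt pt (-adjD f (y t) (pt t) - adjD g (y t) (p t)) (Icc 0 T) t) ∧
  (∀ t ∈ Icc 0 T,
    HasDerivWithinAt p (-adjD f (y t) (pt t) - adjD g (y t) (p t)) (Icc 0 T) t)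

/-- The combined scheme has order (at least) `q`, in the same sense as the forward scheme. The
adjoint stages solve a linear system, so they need not be localized. -/
def CombinedHasOrder (q : ℕ) : Prop :=
  ∀ (m : ℕ) (f g : StateSpace m → StateSpace m), ContDiff ℝ ∞ f → ContDiff ℝ ∞ g →
    ∀ (T : ℝ) (y pt p : ℝ → StateSpace m), 0 < T → IsCombinedSolution f g T y pt p →
      ∀ r > 0, ∃ C : ℝ, ∀ᶠ h in 𝓝[>] (0 : ℝ),
        (∃ Y Pt P : Fin s → StateSpace m,
          M.IsForwardStages f g h (y 0) Y ∧ (∀ i, Y i ∈ Metric.ball (y 0) r) ∧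
          M.IsAdjointStages f g h (pt 0) (p 0) Y Pt P) ∧
        ∀ Y Pt P : Fin s → StateSpace m,
          M.IsForwardStages f g h (y 0) Y → (∀ i, Y i ∈ Metric.ball (y 0) r) →
          M.IsAdjointStages f g h (pt 0) (p 0) Y Pt P →
            ‖M.forwardUpdate f g h (y 0) Y - y h‖ ≤ C * h ^ (q + 1) ∧
            ‖M.adjointUpdate f g h (pt 0) Y Pt P - pt h‖ ≤ C * h ^ (q + 1) ∧
            ‖M.adjointUpdate f g h (p 0) Y Pt P - p h‖ ≤ C * h ^ (q + 1)

end

end IMEXTableau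

/-!
The order conditions of the adjoint variables are inherited from the forward scheme through an
exact discrete duality. Suppose first that `p̃ = p`, so that `p' = -(A + B) p` along the solution
`y`, where `A = f'(y)ᵀ` and `B = g'(y)ᵀ`. The solution of `W' = W (A + B)`, `W(0) = 1` satisfies
`W(t) p(t) = p(0)`. The pair `(y, W)` solves an ordinary differential equation which is again a sum
of an explicit and an implicit part, so the forward scheme computes `W(h)` up to `O(h ^ (q + 1))`.
The coefficients `α̃`, `α`, `β̃`, `β` are exactly those for which the computed values satisfy
`V₁ p₁ = p(0)`. Hence `V₁ (p₁ - p(h)) = (W(h) - V₁) p(h)`, and `V₁` is close to the identity.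

If `p̃ ≠ p`, then `p̃ - p` is constant along the exact and the computed solutions, and the unknowns
`(p, p̃ - p)` solve a larger adjoint system whose two variables do have the same initial value.
-/

section LinearEquations

variable {V : Type*} [NormedAddCommGroup V] [NormedSpace ℝ V]

theorem norm_le_two_mul_norm_apply {T : V →L[ℝ] V} (hT : ‖1 - T‖ ≤ 1 / 2) (v : V) :
    ‖v‖ ≤ 2 * ‖T v‖ := by
  have hsplit : ‖v‖ ≤ ‖T v‖ + ‖(1 - T) v‖ := by simpa using norm_add_le (T v) ((1 - T) v)
  have hsmall : ‖(1 - T) v‖ ≤ 1 / 2 * ‖v‖ := (1 - T).le_of_opNorm_le hT v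
  linarith

theorem norm_sub_le_of_apply_eq {T S : V →L[ℝ] V} (hT : ‖1 - T‖ ≤ 1 / 2) {u v : V}
    (huv : T u = S v) : ‖u - v‖ ≤ 2 * (‖T - S‖ * ‖v‖) :=
  calc ‖u - v‖ ≤ 2 * ‖T (u - v)‖ := norm_le_two_mul_norm_apply hT _
    _ = 2 * ‖(T - S) v‖ := by rw [map_sub, huv, sub_apply, norm_sub_rev]
    _ ≤ 2 * (‖T - S‖ * ‖v‖) := by gcongr; exact (T - S).le_opNorm v

theorem surjective_of_norm_one_sub_le [CompleteSpace V] {T : V →L[ℝ] V} (hT : ‖1 - T‖ ≤ 1 / 2) :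
    Function.Surjective T := by
  have hunit : IsUnit T := by
    simpa using isUnit_one_sub_of_norm_lt_one (hT.trans_lt (by norm_num : (1 / 2 : ℝ) < 1))
  exact (ContinuousLinearMap.isUnit_iff_bijective.1 hunit).surjective

variable [CompleteSpace V] {X : Type*} [TopologicalSpace X] {K : Set X}

theorem eventually_exists_eq_add_smul_apply (hK : IsCompact K) {L : X → V →L[ℝ] V}
    (hL : ContinuousOn L K) :
    ∀ᶠ h in 𝓝 (0 : ℝ), ∀ x ∈ K, ∀ b, ∃ v, v = b + h • L x v ∧ ‖v‖ ≤ 2 * ‖b‖ := by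
  obtain ⟨C, hC⟩ := hK.exists_bound_of_continuousOn hL
  have hsmall : ∀ᶠ h : ℝ in 𝓝 0, ‖h‖ * C < 1 / 2 :=
    ((by fun_prop : Continuous fun h : ℝ => ‖h‖ * C).tendsto' 0 0 (by simp)).eventually_lt_const
      (by norm_num)
  filter_upwards [hsmall] with h hh x hx b
  have hT : ‖1 - (1 - h • L x)‖ ≤ 1 / 2 := by
    rw [sub_sub_cancel, norm_smul]
    exact (mul_le_mul_of_nonneg_left (hC x hx) (norm_nonneg h)).trans hh.le
  obtain ⟨v, hv⟩ := surjective_of_norm_one_sub_le hT b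
  exact ⟨v, sub_eq_iff_eq_add.1 hv, hv ▸ norm_le_two_mul_norm_apply hT v⟩

theorem eventually_exists_eq_add_smul_sum {ι : Type*} [Fintype ι] (hK : IsCompact K)
    {L : ι → ι → X → V →L[ℝ] V} (hL : ∀ i j, ContinuousOn (L i j) K) :
    ∀ᶠ h in 𝓝 (0 : ℝ), ∀ x ∈ K, ∀ b : ι → V,
      ∃ v : ι → V, (∀ i, v i = b i + h • ∑ j, L i j x (v j)) ∧ ‖v‖ ≤ 2 * ‖b‖ := by
  classical
  have hcont : ContinuousOn (fun x => ∑ i, ∑ j, ContinuousLinearMap.single ℝ (fun _ : ι => V) i ∘L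
      L i j x ∘L ContinuousLinearMap.proj j) K := by
    refine continuousOn_finsetSum _ fun i _ => continuousOn_finsetSum _ fun j _ => ?_
    exact continuousOn_const.clm_comp ((hL i j).clm_comp continuousOn_const)
  filter_upwards [eventually_exists_eq_add_smul_apply hK hcont] with h hh x hx b
  obtain ⟨v, hv, hbound⟩ := hh x hx b
  refine ⟨v, fun i => ?_, hbound⟩
  simpa [Finset.sum_apply, Pi.single_apply] using congrFun hv i

end LinearEquations

section LinearODE

/-- Right multiplication `T * S` of operators, as a continuous linear function of `S` and `T`. -/
noncomputable def mulRightCLM {F : Type*} [NormedAddCommGroup F] [NormedSpace ℝ F] :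
    (F →L[ℝ] F) →L[ℝ] (F →L[ℝ] F) →L[ℝ] F →L[ℝ] F :=
  (ContinuousLinearMap.compL ℝ F F F).flip

@[simp]
theorem mulRightCLM_apply {F : Type*} [NormedAddCommGroup F] [NormedSpace ℝ F]
    (S T : F →L[ℝ] F) : mulRightCLM S T = T * S :=
  rfl

theorem tendsto_nhdsGT_of_continuousOn_Icc {X : Type*} [TopologicalSpace X] {x : ℝ → X} {a b : ℝ}
    (hab : a < b) (hx : ContinuousOn x (Icc a b)) : Tendsto x (𝓝[>] a) (𝓝 (x a)) := by
  have ha : ContinuousWithinAt x (Icc a b) a := hx a (left_mem_Icc.2 hab.le)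
  rw [ContinuousWithinAt, nhdsWithin_Icc_eq_nhdsGE hab] at ha
  exact ha.mono_left (nhdsWithin_mono _ Ioi_subset_Ici_self)

variable {V : Type*} [NormedAddCommGroup V] [NormedSpace ℝ V]

theorem eq_of_hasDerivWithinAt_zero {x : ℝ → V} {a b : ℝ}
    (hx : ∀ t ∈ Icc a b, HasDerivWithinAt x 0 (Icc a b) t) : ∀ t ∈ Icc a b, x t = x a :=
  constant_of_derivWithin_zero (fun t ht => (hx t ht).differentiableWithinAt) fun t ht =>
    (hx t (Ico_subset_Icc_self ht)).derivWithin
      (uniqueDiffOn_Icc (ht.1.trans_lt ht.2) t (Ico_subset_Icc_self ht))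

theorem exists_isIntegralCurveOn_clm [CompleteSpace V] {L : ℝ → V →L[ℝ] V} {T : ℝ} (hT : 0 < T)
    (hL : ContinuousOn L (Icc 0 T)) (x₀ : V) :
    ∃ δ ∈ Ioc 0 T, ∃ x : ℝ → V, x 0 = x₀ ∧ IsIntegralCurveOn x (fun t => L t) (Icc 0 δ) := by
  obtain ⟨C, hC⟩ := isCompact_Icc.exists_bound_of_continuousOn hL
  lift C to NNReal using (norm_nonneg _).trans (hC 0 (left_mem_Icc.2 hT.le))
  set N : NNReal := C * (‖x₀‖₊ + 1) with hN
  obtain ⟨δ, hδ, hδT, hNδ⟩ : ∃ δ, 0 < δ ∧ δ ≤ T ∧ N * δ ≤ 1 := by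
    refine ⟨min T (N + 1)⁻¹, by positivity, min_le_left _ _, ?_⟩
    calc (N : ℝ) * min T (N + 1)⁻¹ ≤ (N + 1) * (N + 1 : ℝ)⁻¹ := by
          gcongr
          exacts [by linarith, min_le_right _ _]
      _ = 1 := mul_inv_cancel₀ (by positivity)
  have hsub : Icc 0 δ ⊆ Icc 0 T := Icc_subset_Icc_right hδT
  have hPL : IsPicardLindelof (fun t => L t) (⟨0, left_mem_Icc.2 hδ.le⟩ : Icc 0 δ) x₀ 1 0 N C :=
    { lipschitzOnWith := fun t ht =>
        ((L t).lipschitzWith_of_opNorm_le (hC t (hsub ht))).lipschitzOnWith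
      continuousOn := fun x _ => (hL.mono hsub).clm_apply continuousOn_const
      norm_le := fun t ht x hx => by
        have hx' : ‖x‖ ≤ ‖x₀‖ + 1 := norm_le_of_mem_closedBall hx
        simpa [hN] using (L t).le_of_opNorm_le_of_le (hC t (hsub ht)) hx'
      mul_max_le := by simpa [hδ.le] using hNδ }
  obtain ⟨x, hx₀, hx⟩ := hPL.exists_eq_forall_mem_Icc_hasDerivWithinAt₀
  exact ⟨δ, ⟨hδ, hδT⟩, x, hx₀, hx⟩

theorem apply_eq_of_dual_isIntegralCurveOn {L : ℝ → V →L[ℝ] V} {W : ℝ → V →L[ℝ] V} {p : ℝ → V}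
    {T : ℝ} (hW : IsIntegralCurveOn W (fun t => mulRightCLM (L t)) (Icc 0 T))
    (hp : IsIntegralCurveOn p (fun t p => -L t p) (Icc 0 T)) :
    ∀ t ∈ Icc 0 T, W t (p t) = W 0 (p 0) :=
  eq_of_hasDerivWithinAt_zero fun t ht =>
    ((hW t ht).clm_apply (hp t ht)).congr_deriv (by simp)

end LinearODE

theorem contDiff_adjoint_fderiv {E F : Type*} [NormedAddCommGroup E] [InnerProductSpace ℝ E]
    [CompleteSpace E] [NormedAddCommGroup F] [InnerProductSpace ℝ F] [CompleteSpace F]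
    {m n : WithTop ℕ∞} {f : E → F} (hf : ContDiff ℝ n f) (hmn : m + 1 ≤ n) :
    ContDiff ℝ m fun x => ContinuousLinearMap.adjoint (fderiv ℝ f x) := by
  have hadjoint : IsBoundedLinearMap ℝ (ContinuousLinearMap.adjoint : (E →L[ℝ] F) → F →L[ℝ] E) :=
    IsLinearMap.with_bound ⟨map_add _, by simp⟩ 1 (by simp)
  exact hadjoint.contDiff.comp (hf.fderiv_right hmn)

theorem sum_eq_sum_apply_of_transposed {ι F : Type*} [Fintype ι] [NormedAddCommGroup F]
    [NormedSpace ℝ F] {V : ι → F →L[ℝ] F} {S : ι → ι → F →L[ℝ] F} {u D : ι → F}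
    (hV : ∀ i, V i = 1 + ∑ j, V j * S i j) (hD : ∀ i, D i = u i + ∑ j, S j i (D j)) :
    ∑ i, D i = ∑ i, V i (u i) := by
  have hV' : ∀ i, D i = V i (D i) - ∑ j, V j (S i j (D i)) := fun i => by
    have happly := congrArg (fun T : F →L[ℝ] F => T (D i)) (hV i)
    simpa [sum_apply, eq_sub_iff_add_eq] using happly.symm
  have hD' : ∀ i, u i = D i - ∑ j, S j i (D j) := fun i => eq_sub_of_add_eq (hD i).symm
  calc ∑ i, D i = ∑ i, V i (D i) - ∑ i, ∑ j, V j (S i j (D i)) := by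
        rw [← Finset.sum_sub_distrib]
        exact Finset.sum_congr rfl fun i _ => hV' i
    _ = ∑ i, V i (D i) - ∑ i, ∑ j, V i (S j i (D j)) := by rw [Finset.sum_comm]
    _ = ∑ i, V i (u i) := by
        simp only [hD', map_sub, map_sum, Finset.sum_sub_distrib]

namespace IMEXTableau

noncomputable section

variable {s : ℕ} (M : IMEXTableau s)

section Schemes

variable {E F : Type*} [NormedAddCommGroup E] [NormedSpace ℝ E] [NormedAddCommGroup F]
  [NormedSpace ℝ F]

/-- The stage equations of `IsForwardStages` in an arbitrary normed space, so that the scheme can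
also be applied to a system that carries additional unknowns. -/
def IsStages (f g : E → E) (h : ℝ) (x₀ : E) (X : Fin s → E) : Prop :=
  ∀ i, X i = x₀ + h • ∑ j, M.aE i j • f (X j) + h • ∑ j, M.aI i j • g (X j)

/-- The new value `forwardUpdate` in an arbitrary normed space. -/
def update (f g : E → E) (h : ℝ) (x₀ : E) (X : Fin s → E) : E :=
  x₀ + h • ∑ i, M.wE i • f (X i) + h • ∑ i, M.wI i • g (X i)

/-- The vector field of `y' = f(y)`, `W' = W A(y)`. If `A` is a transposed Jacobian, then `W` is a
transposed fundamental matrix. -/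
def augmentedField (f : E → E) (A : E → F →L[ℝ] F) (x : E × (F →L[ℝ] F)) : E × (F →L[ℝ] F) :=
  (f x.1, x.2 * A x.1)

/-- Stages of the forward scheme for `W' = W A + W B`, `W 0 = 1`, where `A j` and `B j` are the
values of the coefficients at stage `j`. -/
def IsFundamentalStages (A B : Fin s → F →L[ℝ] F) (h : ℝ) (V : Fin s → F →L[ℝ] F) : Prop :=
  ∀ i, V i = 1 + h • ∑ j, M.aE i j • (V j * A j) + h • ∑ j, M.aI i j • (V j * B j)

/-- The new value of `W` computed from the stages of `IsFundamentalStages`. -/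
def fundamentalUpdate (A B : Fin s → F →L[ℝ] F) (h : ℝ) (V : Fin s → F →L[ℝ] F) : F →L[ℝ] F :=
  1 + h • ∑ i, M.wE i • (V i * A i) + h • ∑ i, M.wI i • (V i * B i)

/-- The stage equations of `IsAdjointStages` with arbitrary linear maps `A j` and `B j` in place of
the transposed Jacobians at stage `j`. -/
def IsLinearAdjointStages (A B : Fin s → F →L[ℝ] F) (h : ℝ) (pt₀ p₀ : F) (Pt P : Fin s → F) :
    Prop :=
  (∀ i, Pt i = pt₀ - h • ∑ j, M.alphaE i j • A j (Pt j) - h • ∑ j, M.alphaI i j • B j (P j)) ∧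
  (∀ i, P i = p₀ - h • ∑ j, M.betaE i j • A j (Pt j) - h • ∑ j, M.betaI i j • B j (P j))

/-- The new value `adjointUpdate` with arbitrary linear maps in place of the transposed
Jacobians. -/
def linearAdjointUpdate (A B : Fin s → F →L[ℝ] F) (h : ℝ) (p₀ : F) (Pt P : Fin s → F) : F :=
  p₀ - h • ∑ i, M.wE i • A i (Pt i) - h • ∑ i, M.wI i • B i (P i)

/-- The contribution of stage `i` to the increment `Δ` of the adjoint variables. -/
def adjointSlope (A B : Fin s → F →L[ℝ] F) (Pt P : Fin s → F) (i : Fin s) : F :=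
  M.wE i • A i (Pt i) + M.wI i • B i (P i)

end Schemes

section Duality

variable {M} {F : Type*} [NormedAddCommGroup F] [NormedSpace ℝ F] {A B : Fin s → F →L[ℝ] F} {h : ℝ}
  {pt₀ p₀ : F} {Pt P : Fin s → F}

theorem linearAdjointUpdate_eq :
    M.linearAdjointUpdate A B h p₀ Pt P = p₀ - h • ∑ i, M.adjointSlope A B Pt P i := by
  simp only [linearAdjointUpdate, adjointSlope, Finset.sum_add_distrib, smul_add, sub_sub]

/-- For `c = ω̃ i` and `c = ω i` this is a stage equation in backward form: it starts from the new
value, and its coefficients are transposed coefficients of the forward scheme. -/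
theorem smul_adjointStage_eq {c : ℝ} (hc : c ≠ 0) (a : Fin s → ℝ) {q q₀ : F}
    (hq : q = q₀ - h • ∑ j, (M.wE j - M.wE j / c * a j) • A j (Pt j)
      - h • ∑ j, (M.wI j - M.wI j / c * a j) • B j (P j)) :
    c • q = c • M.linearAdjointUpdate A B h q₀ Pt P
      + h • ∑ j, a j • M.adjointSlope A B Pt P j := by
  have hslope : ∀ j, c • ((M.wE j - M.wE j / c * a j) • A j (Pt j)
      + (M.wI j - M.wI j / c * a j) • B j (P j))
        = c • M.adjointSlope A B Pt P j - a j • M.adjointSlope A B Pt P j := fun j => by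
    simp only [adjointSlope]
    match_scalars <;> field_simp
  have hsum : c • (∑ j, (M.wE j - M.wE j / c * a j) • A j (Pt j)
      + ∑ j, (M.wI j - M.wI j / c * a j) • B j (P j))
        = c • ∑ j, M.adjointSlope A B Pt P j - ∑ j, a j • M.adjointSlope A B Pt P j := by
    rw [← Finset.sum_add_distrib, Finset.smul_sum, Finset.smul_sum, ← Finset.sum_sub_distrib]
    exact Finset.sum_congr rfl fun j _ => hslope j
  rw [linearAdjointUpdate_eq, hq, sub_sub, ← smul_add, smul_sub, smul_comm c h, hsum]
  module

theorem IsLinearAdjointStages.adjointSlope_eq (hwE : ∀ i, M.wE i ≠ 0) (hwI : ∀ i, M.wI i ≠ 0)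
    (hP : M.IsLinearAdjointStages A B h p₀ p₀ Pt P) (i : Fin s) :
    M.adjointSlope A B Pt P i
      = (M.wE i • A i + M.wI i • B i) (M.linearAdjointUpdate A B h p₀ Pt P)
        + ∑ j, (h • (M.aE j i • A i + M.aI j i • B i)) (M.adjointSlope A B Pt P j) := by
  have hslope : M.adjointSlope A B Pt P i = A i (M.wE i • Pt i) + B i (M.wI i • P i) := by
    simp only [adjointSlope, map_smul]
  rw [hslope, smul_adjointStage_eq (hwE i) (fun j => M.aE j i) (hP.1 i),
    smul_adjointStage_eq (hwI i) (fun j => M.aI j i) (hP.2 i)]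
  simp only [map_add, map_smul, map_sum, add_apply, smul_apply, ← Finset.smul_sum,
    Finset.sum_add_distrib]
  module

/-- The discrete counterpart of `W(t) p(t) = p(0)`. -/
theorem IsFundamentalStages.update_apply_linearAdjointUpdate (hwE : ∀ i, M.wE i ≠ 0)
    (hwI : ∀ i, M.wI i ≠ 0) {V : Fin s → F →L[ℝ] F} (hV : M.IsFundamentalStages A B h V)
    (hP : M.IsLinearAdjointStages A B h p₀ p₀ Pt P) :
    M.fundamentalUpdate A B h V (M.linearAdjointUpdate A B h p₀ Pt P) = p₀ := by
  have hV' : ∀ i, V i = 1 + ∑ j, V j * h • (M.aE i j • A j + M.aI i j • B j) := fun i => by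
    rw [hV i]
    simp only [mul_smul_comm, mul_add, smul_add, Finset.sum_add_distrib, Finset.smul_sum, add_assoc]
  set p₁ := M.linearAdjointUpdate A B h p₀ Pt P with hp₁
  have hsum : ∑ i, M.adjointSlope A B Pt P i = ∑ i, V i ((M.wE i • A i + M.wI i • B i) p₁) :=
    sum_eq_sum_apply_of_transposed hV' (hP.adjointSlope_eq hwE hwI)
  calc M.fundamentalUpdate A B h V p₁
      = p₁ + h • ∑ i, V i ((M.wE i • A i + M.wI i • B i) p₁) := by
        simp [fundamentalUpdate, sum_apply, Finset.sum_add_distrib, add_assoc]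
    _ = p₀ := by rw [← hsum, hp₁, linearAdjointUpdate_eq, sub_add_cancel]

end Duality

section Augmented

variable {M} {E F : Type*} [NormedAddCommGroup E] [NormedSpace ℝ E] [NormedAddCommGroup F]
  [NormedSpace ℝ F] {f g : E → E} {A B : E → F →L[ℝ] F}

theorem contDiff_augmentedField {n : WithTop ℕ∞} (hf : ContDiff ℝ n f) (hA : ContDiff ℝ n A) :
    ContDiff ℝ n (augmentedField f A) :=
  (hf.comp contDiff_fst).prodMk (contDiff_snd.clm_comp (hA.comp contDiff_fst))

theorem isStages_augmentedField_iff {h : ℝ} {y₀ : E} {Y : Fin s → E} {V : Fin s → F →L[ℝ] F} :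
    M.IsStages (augmentedField f A) (augmentedField g B) h (y₀, 1) (fun i => (Y i, V i)) ↔
      M.IsStages f g h y₀ Y ∧ M.IsFundamentalStages (A ∘ Y) (B ∘ Y) h V := by
  simp [IsStages, IsFundamentalStages, augmentedField, Prod.ext_iff, Prod.fst_sum, Prod.snd_sum,
    forall_and]

theorem update_augmentedField_snd {h : ℝ} {y₀ : E} {Y : Fin s → E} {V : Fin s → F →L[ℝ] F} :
    (M.update (augmentedField f A) (augmentedField g B) h (y₀, 1) (fun i => (Y i, V i))).2
      = M.fundamentalUpdate (A ∘ Y) (B ∘ Y) h V := by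
  simp [update, fundamentalUpdate, augmentedField, Prod.snd_sum]

end Augmented

section Transport

variable {M} {E E' : Type*} [NormedAddCommGroup E] [NormedSpace ℝ E] [NormedAddCommGroup E']
  [NormedSpace ℝ E'] {f g : E → E} {f' g' : E' → E'} {h : ℝ} {x₀ : E} {X : Fin s → E}

theorem IsStages.map (e : E →ₗ[ℝ] E') (hf : Function.Semiconj e f f')
    (hg : Function.Semiconj e g g') (hX : M.IsStages f g h x₀ X) :
    M.IsStages f' g' h (e x₀) (e ∘ X) := fun i => by
  simpa [hf.eq, hg.eq] using congrArg e (hX i)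

theorem map_update (e : E →ₗ[ℝ] E') (hf : Function.Semiconj e f f')
    (hg : Function.Semiconj e g g') :
    e (M.update f g h x₀ X) = M.update f' g' h (e x₀) (e ∘ X) := by
  simp [update, hf.eq, hg.eq]

theorem ForwardHasOrder.exists_norm_update_sub_le [FiniteDimensional ℝ E] {q : ℕ}
    (hM : M.ForwardHasOrder q) (hf : ContDiff ℝ ∞ f) (hg : ContDiff ℝ ∞ g) {T : ℝ} (hT : 0 < T)
    {x : ℝ → E} (hx : IsIntegralCurveOn x (fun _ x => f x + g x) (Icc 0 T)) (R : ℝ) :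
    ∃ C : ℝ, ∀ᶠ h in 𝓝[>] (0 : ℝ), ∀ X : Fin s → E, M.IsStages f g h (x 0) X →
      (∀ i, ‖X i - x 0‖ ≤ R) → ‖M.update f g h (x 0) X - x h‖ ≤ C * h ^ (q + 1) := by
  let e : E ≃L[ℝ] StateSpace (Module.finrank ℝ E) := ContinuousLinearEquiv.ofFinrankEq (by simp)
  let eL : E →L[ℝ] StateSpace (Module.finrank ℝ E) := e
  let eLsymm : StateSpace (Module.finrank ℝ E) →L[ℝ] E := e.symm
  let conj (k : E → E) : StateSpace _ → StateSpace _ := fun u => e (k (e.symm u))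
  have hconj : ∀ k, Function.Semiconj eL k (conj k) := fun k x => by simp [conj, eL]
  have hsmooth : ∀ {k}, ContDiff ℝ ∞ k → ContDiff ℝ ∞ (conj k) := fun hk =>
    e.contDiff.comp (hk.comp e.symm.contDiff)
  have hex : IsForwardSolution (conj f) (conj g) T (eL ∘ x) := fun t ht =>
    (eL.hasFDerivAt.comp_hasDerivWithinAt t (hx t ht)).congr_deriv (by simp [conj, eL])
  have hr : 0 < ‖eL‖ * |R| + 1 := by positivity
  obtain ⟨C, hC⟩ := hM _ _ _ (hsmooth hf) (hsmooth hg) T _ hT hex _ hr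
  refine ⟨‖eLsymm‖ * C, ?_⟩
  filter_upwards [hC] with h hh X hX hXR
  have hball : ∀ i, eL (X i) ∈ Metric.ball (eL (x 0)) (‖eL‖ * |R| + 1) := fun i => by
    rw [mem_ball_iff_norm, ← map_sub]
    exact (eL.le_opNorm_of_le ((hXR i).trans (le_abs_self R))).trans_lt (lt_add_one _)
  have herr : ‖eL (M.update f g h (x 0) X - x h)‖ ≤ C * h ^ (q + 1) := by
    rw [map_sub, ← ContinuousLinearMap.coe_coe, map_update _ (hconj f) (hconj g)]
    exact hh.2 _ (hX.map _ (hconj f) (hconj g)) hball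
  calc ‖M.update f g h (x 0) X - x h‖ = ‖eLsymm (eL (M.update f g h (x 0) X - x h))‖ := by
        simp [eL, eLsymm]
    _ ≤ ‖eLsymm‖ * (C * h ^ (q + 1)) := eLsymm.le_opNorm_of_le herr
    _ = ‖eLsymm‖ * C * h ^ (q + 1) := (mul_assoc _ _ _).symm

end Transport

section StageExistence

variable {X F : Type*} [TopologicalSpace X] [NormedAddCommGroup F] [NormedSpace ℝ F]
  [CompleteSpace F] {A B : Fin s → X → F →L[ℝ] F} {K : Set X}

theorem eventually_exists_isFundamentalStages (hK : IsCompact K)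
    (hA : ∀ j, ContinuousOn (A j) K) (hB : ∀ j, ContinuousOn (B j) K) :
    ∀ᶠ h in 𝓝 (0 : ℝ), ∀ x ∈ K,
      ∃ V, M.IsFundamentalStages (A · x) (B · x) h V ∧ ∀ i, ‖V i‖ ≤ 2 := by
  have hcont : ∀ i j, ContinuousOn 
      (fun x => mulRightCLM (M.aE i j • A j x + M.aI i j • B j x)) K := fun i j =>
    mulRightCLM.continuous.comp_continuousOn (by fun_prop)
  filter_upwards [eventually_exists_eq_add_smul_sum hK hcont] with h hh x hx
  obtain ⟨V, hV, hbound⟩ := hh x hx fun _ => 1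
  have hone : ‖fun _ : Fin s => (1 : F →L[ℝ] F)‖ ≤ 1 :=
    (pi_norm_le_iff_of_nonneg zero_le_one).2 fun _ => ContinuousLinearMap.norm_id_le
  refine ⟨V, fun i => ?_, fun i => (norm_le_pi_norm V i).trans (by linarith)⟩
  simpa [mul_add, Finset.sum_add_distrib, smul_add, ← add_assoc] using hV i

/-- The pair `(Pt i, P i)` is a single unknown of a linear system in `F × F`. -/
theorem eventually_exists_isLinearAdjointStages (hK : IsCompact K)
    (hA : ∀ j, ContinuousOn (A j) K) (hB : ∀ j, ContinuousOn (B j) K) :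
    ∀ᶠ h in 𝓝 (0 : ℝ), ∀ x ∈ K, ∀ pt₀ p₀ : F,
      ∃ Pt P, M.IsLinearAdjointStages (A · x) (B · x) h pt₀ p₀ Pt P := by
  let fst := ContinuousLinearMap.fst ℝ F F
  let snd := ContinuousLinearMap.snd ℝ F F
  let inl := ContinuousLinearMap.inl ℝ F F
  let inr := ContinuousLinearMap.inr ℝ F F
  let L (i j : Fin s) (x : X) : F × F →L[ℝ] F × F :=
    -((M.alphaE i j • inl + M.betaE i j • inr) ∘L A j x ∘L fst
      + (M.alphaI i j • inl + M.betaI i j • inr) ∘L B j x ∘L snd)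
  have hL : ∀ i j, ContinuousOn (L i j) K := fun i j =>
    ((continuousOn_const.clm_comp ((hA j).clm_comp continuousOn_const)).add
      (continuousOn_const.clm_comp ((hB j).clm_comp continuousOn_const))).neg
  have hL_apply : ∀ i j x z, L i j x z = -(M.alphaE i j • A j x z.1 + M.alphaI i j • B j x z.2,
      M.betaE i j • A j x z.1 + M.betaI i j • B j x z.2) := fun i j x z => by
    simp [L, inl, inr, fst, snd]
  filter_upwards [eventually_exists_eq_add_smul_sum hK hL] with h hh x hx pt₀ p₀
  obtain ⟨Q, hQ, -⟩ := hh x hx fun _ => (pt₀, p₀)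
  refine ⟨fun i => (Q i).1, fun i => (Q i).2, fun i => ?_, fun i => ?_⟩
  · refine (congrArg Prod.fst (hQ i)).trans ?_
    simp only [hL_apply, Prod.fst_add, Prod.smul_fst, Prod.fst_sum, Prod.fst_neg,
      Finset.sum_neg_distrib, Finset.sum_add_distrib]
    module
  · refine (congrArg Prod.snd (hQ i)).trans ?_
    simp only [hL_apply, Prod.snd_add, Prod.smul_snd, Prod.snd_sum, Prod.snd_neg,
      Finset.sum_neg_distrib, Finset.sum_add_distrib]
    module

end StageExistence
section Error

variable {M} {E F : Type*} [NormedAddCommGroup E] [NormedSpace ℝ E] [FiniteDimensional ℝ E]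
  [NormedAddCommGroup F] [NormedSpace ℝ F] [FiniteDimensional ℝ F] {f g : E → E}
  {A B : E → F →L[ℝ] F} {q : ℕ} {T : ℝ} {y : ℝ → E}

theorem ForwardHasOrder.exists_norm_fundamentalUpdate_sub_le (hM : M.ForwardHasOrder q)
    (hf : ContDiff ℝ ∞ f) (hg : ContDiff ℝ ∞ g) (hA : ContDiff ℝ ∞ A) (hB : ContDiff ℝ ∞ B)
    (hT : 0 < T) (hy : IsIntegralCurveOn y (fun _ y => f y + g y) (Icc 0 T)) {W : ℝ → F →L[ℝ] F}
    (hW₀ : W 0 = 1) (hW : IsIntegralCurveOn W (fun t => mulRightCLM (A (y t) + B (y t))) (Icc 0 T))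
    (r : ℝ) :
    ∃ C : ℝ, ∀ᶠ h in 𝓝[>] (0 : ℝ), ∀ Y : Fin s → E, M.IsStages f g h (y 0) Y →
      (∀ i, Y i ∈ Metric.ball (y 0) r) →
        ∃ V, M.IsFundamentalStages (A ∘ Y) (B ∘ Y) h V ∧
          ‖M.fundamentalUpdate (A ∘ Y) (B ∘ Y) h V - W h‖ ≤ C * h ^ (q + 1) := by
  have hyW : IsIntegralCurveOn (fun t => (y t, W t))
      (fun _ x => augmentedField f A x + augmentedField g B x) (Icc 0 T) := fun t ht =>
    ((hy t ht).prodMk (hW t ht)).congr_deriv (by simp [augmentedField])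
  obtain ⟨C, hC⟩ := hM.exists_norm_update_sub_le (contDiff_augmentedField hf hA)
    (contDiff_augmentedField hg hB) hT hyW (max r 3)
  have hK : IsCompact (univ.pi fun _ : Fin s => Metric.closedBall (y 0) r) :=
    isCompact_univ_pi fun _ => isCompact_closedBall _ _
  have hV := M.eventually_exists_isFundamentalStages hK
    (fun j => (hA.continuous.comp (continuous_apply j)).continuousOn)
    (fun j => (hB.continuous.comp (continuous_apply j)).continuousOn)
  refine ⟨C, ?_⟩
  filter_upwards [hC, hV.filter_mono nhdsWithin_le_nhds] with h hCh hVh Y hY hball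
  obtain ⟨V, hV, hV₂⟩ := hVh Y fun i _ => Metric.ball_subset_closedBall (hball i)
  have hone : ‖(1 : F →L[ℝ] F)‖ ≤ 1 := ContinuousLinearMap.norm_id_le
  have hnear : ∀ i, ‖(Y i, V i) - (y 0, W 0)‖ ≤ max r 3 := fun i =>
    max_le_max (mem_ball_iff_norm.1 (hball i)).le <|
      (norm_sub_le _ _).trans (by rw [hW₀]; linarith [hV₂ i])
  have herr := hCh (fun i => (Y i, V i))
    (by rw [hW₀]; exact isStages_augmentedField_iff.2 ⟨hY, hV⟩) hnear
  refine ⟨V, hV, ?_⟩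
  rw [hW₀] at herr
  rw [← update_augmentedField_snd]
  exact (norm_snd_le _).trans herr

/-- Since `V₁ p₁ = p 0 = W(h) p(h)` for the computed values `V₁` and `p₁`, the error of `p₁` is
controlled by that of `V₁`. -/
theorem ForwardHasOrder.exists_norm_linearAdjointUpdate_sub_le_of_eq (hM : M.ForwardHasOrder q)
    (hwE : ∀ i, M.wE i ≠ 0) (hwI : ∀ i, M.wI i ≠ 0)
    (hf : ContDiff ℝ ∞ f) (hg : ContDiff ℝ ∞ g) (hA : ContDiff ℝ ∞ A) (hB : ContDiff ℝ ∞ B)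
    (hT : 0 < T) (hy : IsIntegralCurveOn y (fun _ y => f y + g y) (Icc 0 T)) {p : ℝ → F}
    (hp : IsIntegralCurveOn p (fun t p => -(A (y t) + B (y t)) p) (Icc 0 T)) (r : ℝ) :
    ∃ C : ℝ, ∀ᶠ h in 𝓝[>] (0 : ℝ), ∀ Y : Fin s → E, M.IsStages f g h (y 0) Y →
      (∀ i, Y i ∈ Metric.ball (y 0) r) → ∀ Pt P : Fin s → F,
        M.IsLinearAdjointStages (A ∘ Y) (B ∘ Y) h (p 0) (p 0) Pt P →
          ‖M.linearAdjointUpdate (A ∘ Y) (B ∘ Y) h (p 0) Pt P - p h‖ ≤ C * h ^ (q + 1) := by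
  have hL : ContinuousOn (fun t => A (y t) + B (y t)) (Icc 0 T) :=
    (hA.continuous.add hB.continuous).comp_continuousOn hy.continuousOn
  obtain ⟨δ, ⟨hδ, hδT⟩, W, hW₀, hW⟩ := exists_isIntegralCurveOn_clm hT
    (mulRightCLM.continuous.comp_continuousOn hL) 1
  have hsub : Icc 0 δ ⊆ Icc 0 T := Icc_subset_Icc_right hδT
  obtain ⟨C, hC⟩ :=
    hM.exists_norm_fundamentalUpdate_sub_le hf hg hA hB hδ (hy.mono hsub) hW₀ hW r
  have hWlim : Tendsto W (𝓝[>] 0) (𝓝 1) := hW₀ ▸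
    tendsto_nhdsGT_of_continuousOn_Icc hδ hW.continuousOn
  have hplim : Tendsto p (𝓝[>] 0) (𝓝 (p 0)) :=
    tendsto_nhdsGT_of_continuousOn_Icc hT hp.continuousOn
  have hpow : Tendsto (fun h : ℝ => C * h ^ (q + 1)) (𝓝[>] 0) (𝓝 0) :=
    ((by fun_prop : Continuous fun h : ℝ => C * h ^ (q + 1)).tendsto' 0 0 (by simp)).mono_left
      nhdsWithin_le_nhds
  have hclose : ∀ᶠ h in 𝓝[>] (0 : ℝ), C * h ^ (q + 1) + ‖W h - 1‖ < 1 / 2 := by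
    have hlim := hpow.add (hWlim.sub_const 1).norm
    rw [sub_self, norm_zero, add_zero] at hlim
    exact hlim.eventually_lt_const (by norm_num)
  have hpbound : ∀ᶠ h in 𝓝[>] (0 : ℝ), ‖p h‖ < ‖p 0‖ + 1 :=
    hplim.norm.eventually_lt_const (lt_add_one _)
  refine ⟨2 * (C * (‖p 0‖ + 1)), ?_⟩
  filter_upwards [hC, hclose, hpbound, Ioc_mem_nhdsGT hδ] with h hCh hhW hhp hhδ Y hY hball Pt P hP
  obtain ⟨V, hV, herr⟩ := hCh Y hY hball
  set V₁ := M.fundamentalUpdate (A ∘ Y) (B ∘ Y) h V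
  set p₁ := M.linearAdjointUpdate (A ∘ Y) (B ∘ Y) h (p 0) Pt P
  have hV₁ : ‖1 - V₁‖ ≤ 1 / 2 := by
    rw [norm_sub_rev]
    linarith [norm_sub_le_norm_sub_add_norm_sub V₁ (W h) 1]
  have hconserved : V₁ p₁ = W h (p h) := by
    rw [hV.update_apply_linearAdjointUpdate hwE hwI hP,
      apply_eq_of_dual_isIntegralCurveOn hW (hp.mono hsub) h (Ioc_subset_Icc_self hhδ), hW₀]
    rfl
  calc ‖p₁ - p h‖ ≤ 2 * (‖V₁ - W h‖ * ‖p h‖) := norm_sub_le_of_apply_eq hV₁ hconserved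
    _ ≤ 2 * (C * h ^ (q + 1) * (‖p 0‖ + 1)) := by gcongr; exact (norm_nonneg _).trans herr
    _ = 2 * (C * (‖p 0‖ + 1)) * h ^ (q + 1) := by ring

end Error

section Splitting

variable {M} {F : Type*} [NormedAddCommGroup F] [NormedSpace ℝ F]

/-- The coefficient of `p̃` in the adjoint system `p̃' = p' = -A p̃ - B p`, written in the unknowns
`(p, p̃ - p)`. The second unknown is constant, so both variables of this larger system have the same
initial value in the scheme. -/
def splitE (A : F →L[ℝ] F) : F × F →L[ℝ] F × F :=
  ContinuousLinearMap.inl ℝ F F ∘L A ∘L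
    (ContinuousLinearMap.fst ℝ F F + ContinuousLinearMap.snd ℝ F F)

/-- The coefficient of `p` in the adjoint system `p̃' = p' = -A p̃ - B p`, written in the unknowns
`(p, p̃ - p)`. -/
def splitI (B : F →L[ℝ] F) : F × F →L[ℝ] F × F :=
  ContinuousLinearMap.inl ℝ F F ∘L B ∘L ContinuousLinearMap.fst ℝ F F

@[simp]
theorem splitE_apply (A : F →L[ℝ] F) (x : F × F) : splitE A x = (A (x.1 + x.2), 0) :=
  rfl

@[simp]
theorem splitI_apply (B : F →L[ℝ] F) (x : F × F) : splitI B x = (B x.1, 0) :=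
  rfl

theorem contDiff_splitE {E : Type*} [NormedAddCommGroup E] [NormedSpace ℝ E] {n : WithTop ℕ∞}
    {A : E → F →L[ℝ] F} (hA : ContDiff ℝ n A) : ContDiff ℝ n fun y => splitE (A y) :=
  contDiff_const.clm_comp (hA.clm_comp contDiff_const)

theorem contDiff_splitI {E : Type*} [NormedAddCommGroup E] [NormedSpace ℝ E] {n : WithTop ℕ∞}
    {B : E → F →L[ℝ] F} (hB : ContDiff ℝ n B) : ContDiff ℝ n fun y => splitI (B y) :=
  contDiff_const.clm_comp (hB.clm_comp contDiff_const)

variable {A B : Fin s → F →L[ℝ] F} {h : ℝ} {pt₀ p₀ : F} {Pt P : Fin s → F}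

theorem IsLinearAdjointStages.split (hP : M.IsLinearAdjointStages A B h pt₀ p₀ Pt P) :
    M.IsLinearAdjointStages (splitE ∘ A) (splitI ∘ B) h (p₀, pt₀ - p₀) (p₀, pt₀ - p₀)
      (fun i => (Pt i - (pt₀ - p₀), pt₀ - p₀)) (fun i => (P i, pt₀ - p₀)) := by
  refine ⟨fun i => Prod.ext ?_ ?_, fun i => Prod.ext ?_ ?_⟩
  · simp only [hP.1 i, Function.comp_apply, splitE_apply, splitI_apply, sub_add_cancel,
      Prod.fst_sub, Prod.smul_fst, Prod.fst_sum]
    abel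
  · simp [Prod.snd_sum]
  · simp [hP.2 i, Prod.fst_sum]
  · simp [Prod.snd_sum]

theorem linearAdjointUpdate_split_fst (d : F) :
    (M.linearAdjointUpdate (splitE ∘ A) (splitI ∘ B) h (p₀, d) (fun i => (Pt i - d, d))
      (fun i => (P i, d))).1 = M.linearAdjointUpdate A B h p₀ Pt P := by
  simp [linearAdjointUpdate, Prod.fst_sum]

end Splitting

section Order

variable {M}

theorem ForwardHasOrder.exists_norm_linearAdjointUpdate_sub_le {E F : Type*}
    [NormedAddCommGroup E] [NormedSpace ℝ E] [FiniteDimensional ℝ E]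
    [NormedAddCommGroup F] [NormedSpace ℝ F] [FiniteDimensional ℝ F] {f g : E → E}
    {A B : E → F →L[ℝ] F} {q : ℕ} {T : ℝ} {y : ℝ → E} {pt p : ℝ → F} (hM : M.ForwardHasOrder q)
    (hwE : ∀ i, M.wE i ≠ 0) (hwI : ∀ i, M.wI i ≠ 0)
    (hf : ContDiff ℝ ∞ f) (hg : ContDiff ℝ ∞ g) (hA : ContDiff ℝ ∞ A) (hB : ContDiff ℝ ∞ B)
    (hT : 0 < T) (hy : IsIntegralCurveOn y (fun _ y => f y + g y) (Icc 0 T))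
    (hp : IsIntegralCurveOn p (fun t p => -A (y t) (pt t) - B (y t) p) (Icc 0 T))
    (hd : ∀ t ∈ Icc 0 T, pt t - p t = pt 0 - p 0) (r : ℝ) :
    ∃ C : ℝ, ∀ᶠ h in 𝓝[>] (0 : ℝ), ∀ Y : Fin s → E, M.IsStages f g h (y 0) Y →
      (∀ i, Y i ∈ Metric.ball (y 0) r) → ∀ Pt P : Fin s → F,
        M.IsLinearAdjointStages (A ∘ Y) (B ∘ Y) h (pt 0) (p 0) Pt P →
          ‖M.linearAdjointUpdate (A ∘ Y) (B ∘ Y) h (p 0) Pt P - p h‖ ≤ C * h ^ (q + 1) := by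
  set d := pt 0 - p 0
  have hsplit : IsIntegralCurveOn (fun t => (p t, d))
      (fun t x => -(splitE (A (y t)) + splitI (B (y t))) x) (Icc 0 T) := fun t ht => by
    have hpt : p t + d = pt t := by rw [← hd t ht]; abel
    refine ((hp t ht).prodMk (hasDerivWithinAt_const t _ d)).congr_deriv ?_
    simp [hpt, sub_eq_neg_add]
  obtain ⟨C, hC⟩ := hM.exists_norm_linearAdjointUpdate_sub_le_of_eq hwE hwI hf hg
    (contDiff_splitE hA) (contDiff_splitI hB) hT hy hsplit r
  refine ⟨C, ?_⟩
  filter_upwards [hC] with h hCh Y hY hball Pt P hP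
  rw [← linearAdjointUpdate_split_fst d]
  exact (norm_fst_le _).trans (hCh Y hY hball _ _ hP.split)

end Order

end

end IMEXTableau

theorem theorem1_general {s : ℕ} (M : IMEXTableau s) (hwE : ∀ i, M.wE i ≠ 0)
    (hwI : ∀ i, M.wI i ≠ 0) {q : ℕ} (hM : M.ForwardHasOrder q) : M.CombinedHasOrder q := by
  intro m f g hf hg T y pt p hT ⟨hy, hpt, hp⟩ r hr
  have hA := contDiff_adjoint_fderiv hf (m := ∞) (by simp)
  have hB := contDiff_adjoint_fderiv hg (m := ∞) (by simp)
  have hd : ∀ t ∈ Icc 0 T, pt t - p t = pt 0 - p 0 :=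
    eq_of_hasDerivWithinAt_zero fun t ht => ((hpt t ht).sub (hp t ht)).congr_deriv (sub_self _)
  obtain ⟨C₀, hC₀⟩ := hM m f g hf hg T y hT hy r hr
  obtain ⟨C₁, hC₁⟩ :=
    hM.exists_norm_linearAdjointUpdate_sub_le hwE hwI hf hg hA hB hT hy hp hd r
  have hstages := M.eventually_exists_isLinearAdjointStages
    (isCompact_univ_pi fun _ : Fin s => isCompact_closedBall (y 0) r)
    (fun j => (hA.continuous.comp (continuous_apply j)).continuousOn)
    (fun j => (hB.continuous.comp (continuous_apply j)).continuousOn)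
  refine ⟨max C₀ C₁, ?_⟩
  filter_upwards [hC₀, hC₁, hstages.filter_mono nhdsWithin_le_nhds, Ioc_mem_nhdsGT hT]
    with h hforward hadjoint hstages hhT
  have hpow : 0 ≤ h ^ (q + 1) := pow_nonneg hhT.1.le _
  have hle₀ : C₀ * h ^ (q + 1) ≤ max C₀ C₁ * h ^ (q + 1) := by gcongr; exact le_max_left _ _
  have hle₁ : C₁ * h ^ (q + 1) ≤ max C₀ C₁ * h ^ (q + 1) := by gcongr; exact le_max_right _ _
  refine ⟨?_, fun Y Pt P hY hball hP => ?_⟩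
  · obtain ⟨Y, hY, hball⟩ := hforward.1
    obtain ⟨Pt, P, hP⟩ :=
      hstages Y (fun i _ => Metric.ball_subset_closedBall (hball i)) (pt 0) (p 0)
    exact ⟨Y, Pt, P, hY, hball, hP⟩
  · have hy₁ := (hforward.2 Y hY hball).trans hle₀
    have hp₁ := (hadjoint Y hY hball Pt P hP).trans hle₁
    have hpt₁ : M.adjointUpdate f g h (pt 0) Y Pt P - pt h
        = M.adjointUpdate f g h (p 0) Y Pt P - p h := by
      rw [eq_add_of_sub_eq (hd h (Ioc_subset_Icc_self hhT))]
      simp only [IMEXTableau.adjointUpdate]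
      abel
    exact ⟨hy₁, hpt₁ ▸ hp₁, hp₁⟩

theorem theorem1 {s : ℕ} (M : IMEXTableau s) (hwE : ∀ i, M.wE i ≠ 0) (hwI : ∀ i, M.wI i ≠ 0) :
    (M.ForwardHasOrder 1 → M.CombinedHasOrder 1) ∧
    (M.ForwardHasOrder 2 → M.CombinedHasOrder 2) ∧
    (M.ForwardHasOrder 3 →
      ((∑ i, M.wI i * M.gammaI i ^ 2 = 1 / 3 ∧
        ∑ i, M.wI i * M.gammaE i ^ 2 = 1 / 3 ∧
        ∑ i, M.wI i * M.gammaI i * M.gammaE i = 1 / 3) ∨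
       (∑ i, ∑ j, M.wI i * M.aI i j * M.gammaI j = 1 / 6 ∧
        ∑ i, ∑ j, M.wI i * M.aE i j * M.gammaE j = 1 / 6 ∧
        (∑ i, ∑ j, M.wI i * M.aI i j * M.gammaE j = 1 / 6 ∨
         ∑ i, ∑ j, M.wI i * M.aE i j * M.gammaI j = 1 / 6))) →
      M.CombinedHasOrder 3) :=
  ⟨theorem1_general M hwE hwI, theorem1_general M hwE hwI,
    fun hM _ => theorem1_general M hwE hwI hM⟩
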